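/- Let $n\ge 4$. Let $B_n$ be the Artin braid group with its standard generators $\sigma_1,\dots,\sigma_{n-1}$, and let $P_n$ be the pure braid group, i.e. the kernel of the homomorphism $B_n\to S_n$ sending $\sigma_k$ to the transposition $\tau_k=(k,\,k+1)$. For $1\le i<j\le n$ put $A_{i,j}=\sigma_{j-1}\cdots\sigma_{i+1}\sigma_i^2\sigma_{i+1}^{-1}\cdots\sigma_{j-1}^{-1}\in P_n$. Let $\overline P_n=P_n/Z(P_n)$, let $\Gamma_1(G)=G$ and $\Gamma_{i+1}(G)=[G,\Gamma_i(G)]$ denote the lower central series of a group $G$, and let $$\varphi_2\colon \operatorname{Aut}(P_n)\to \operatorname{Aut}\bigl(\Gamma_2(\overline P_n)/\Gamma_3(\overline P_n)\bigr)$$ be the homomorphism that sends an automorphism to the induced one. For $1\le r<s<t\le n$ let $\alpha_{r,s,t}$ be the image in $\Gamma_2(\overline P_n)/\Gamma_3(\overline P_n)$ of the commutator $[A_{r,s},A_{s,t}]$, where $[g,h]=ghg^{-1}h^{-1}$. For $1\le k<n$ let $\omega_k\in\operatorname{Aut}(P_n)$ be the automorphism $x\mapsto\sigma_k^{-1}x\sigma_k$.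 (Composing $\omega_k$ with an automorphism that induces the identity on $\overline P_n$ does not change $\varphi_2(\omega_k)$.) Then there is an isomorphism from the subgroup $\langle\varphi_2(\omega_1),\dots,\varphi_2(\omega_{n-1})\rangle$ onto $S_n$ that sends $\varphi_2(\omega_k)$ to $\tau_k$ for every $1\le k<n$ (it is clearly unique), and the following holds. Let $\alpha\in\operatorname{Aut}(P_n)$ be such that $\varphi_2(\alpha)\in\langle\varphi_2(\omega_1),\dots,\varphi_2(\omega_{n-1})\rangle$, and let $\pi\in S_n$ be the permutation that corresponds to $\varphi_2(\alpha)$ under this isomorphism. Then, for all $1\le r<s<t\le n$, $$\varphi_2(\alpha)(\alpha_{r,s,t})=\begin{cases} \alpha_{\pi(r),\pi(s),\pi(t)} & \text{if } \pi(r)<\pi(s)<\pi(t),\\ \alpha_{\pi(s),\pi(t),\pi(r)} & \text{if } \pi(s)<\pi(t)<\pi(r),\\ \alpha_{\pi(t),\pi(r),\pi(s)} & \text{if } \pi(t)<\pi(r)<\pi(s),\\ \alpha^{-1}_{\pi(r),\pi(t),\pi(s)} & \text{if } \pi(r)<\pi(t)<\pi(s),\\ \alpha^{-1}_{\pi(s),\pi(r),\pi(t)}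 & \text{if } \pi(s)<\pi(r)<\pi(t),\\ \alpha^{-1}_{\pi(t),\pi(s),\pi(r)} & \text{if } \pi(t)<\pi(s)<\pi(r). \end{cases}$$ -/

import Mathlib

open scoped commutatorElement

/-! ### Braid groups and pure braid groups -/

/-- The Artin relators of the braid group on `n` strands, on the generators `σ_0, …, σ_{n-2}`
(numbered from `0`): far commutation and the braid relation. -/
def braidRels (n : ℕ) : Set (FreeGroup (Fin (n - 1))) :=
  {w | ∃ i j : Fin (n - 1), i.val + 2 ≤ j.val ∧
      w = FreeGroup.of i * FreeGroup.of j * (FreeGroup.of j * FreeGroup.of i)⁻¹} ∪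
  {w | ∃ i j : Fin (n - 1), i.val + 1 = j.val ∧
      w = FreeGroup.of j * FreeGroup.of i * FreeGroup.of j *
        (FreeGroup.of i * FreeGroup.of j * FreeGroup.of i)⁻¹}

/-- The Artin braid group `B_n`. -/
abbrev Braid (n : ℕ) : Type := PresentedGroup (braidRels n)

/-- The elementary braid `σ_k`, where `0 ≤ k < n - 1` (strands are numbered `0, …, n-1`). -/
def elemBraid (n : ℕ) (k : Fin (n - 1)) : Braid n := PresentedGroup.of k

/-- The transposition `τ_k = (k, k+1)` of the strands `0, …, n-1`, where `0 ≤ k < n - 1`. -/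
def adjSwap (n : ℕ) (k : Fin (n - 1)) : Equiv.Perm (Fin n) :=
  Equiv.swap ⟨k.val, by omega⟩ ⟨k.val + 1, by omega⟩

theorem swap_braid {X : Type*} [DecidableEq X] (a b c : X) (h₁ : a ≠ b) (h₂ : b ≠ c) (h₃ : a ≠ c) :
    Equiv.swap b c * Equiv.swap a b * Equiv.swap b c =
      Equiv.swap a b * Equiv.swap b c * Equiv.swap a b := by
  rw [Equiv.swap_mul_swap_mul_swap h₁ h₃, Equiv.swap_comm a b, Equiv.swap_comm b c,
    Equiv.swap_mul_swap_mul_swap h₂.symm h₃.symm, Equiv.swap_comm]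

theorem adjSwap_rels (n : ℕ) :
    ∀ w ∈ braidRels n, FreeGroup.lift (adjSwap n) w = 1 := by
  rintro w (⟨i, j, hij, rfl⟩ | ⟨i, j, hij, rfl⟩)
  · simp only [map_mul, map_inv, FreeGroup.lift_apply_of]
    rw [mul_inv_eq_one]
    refine Equiv.Perm.Disjoint.commute fun x => ?_
    by_cases hx : x.val = i.val ∨ x.val = i.val + 1
    · right
      apply Equiv.swap_apply_of_ne_of_ne <;> rw [Ne, Fin.ext_iff] <;> dsimp only <;> omega
    · left
      apply Equiv.swap_apply_of_ne_of_ne <;> rw [Ne, Fin.ext_iff] <;> dsimp only <;> omega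
  · simp only [map_mul, map_inv, FreeGroup.lift_apply_of]
    rw [mul_inv_eq_one]
    obtain ⟨i, hi⟩ := i
    obtain ⟨j, hj⟩ := j
    obtain rfl : i + 1 = j := hij
    simp only [adjSwap]
    exact swap_braid _ _ _ (by simp) (by simp) (by simp [Fin.ext_iff]; omega)

/-- The homomorphism `B_n → S_n` that sends `σ_k` to the transposition `(k, k+1)`. -/
def braidToPerm (n : ℕ) : Braid n →* Equiv.Perm (Fin n) :=
  PresentedGroup.toGroup (adjSwap_rels n)

/-- The pure braid group `P_n`, the kernel of `B_n → S_n`. -/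
abbrev PureBraid (n : ℕ) : Subgroup (Braid n) := (braidToPerm n).ker

/-- `σ_k` for a natural number `k`; the value for `k ≥ n - 1` is immaterial. -/
def elemBraidNat (n : ℕ) (k : ℕ) : Braid n :=
  if h : k < n - 1 then elemBraid n ⟨k, h⟩ else 1

/-- The braid `A_{i,j} = σ_{j-1} ⋯ σ_{i+1} σ_i² σ_{i+1}⁻¹ ⋯ σ_{j-1}⁻¹`, meant for `i < j`
(the list below is `[j-1, …, i+1]`). -/
def pureGenBraid (n : ℕ) (i j : Fin n) : Braid n :=
  ((List.range' (i.val + 1) (j.val - (i.val + 1))).reverse.map (elemBraidNat n)).prod *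
    elemBraidNat n i.val ^ 2 *
    ((List.range' (i.val + 1) (j.val - (i.val + 1))).reverse.map (elemBraidNat n)).prod⁻¹

theorem braidToPerm_elemBraidNat_sq (n : ℕ) (k : ℕ) :
    braidToPerm n (elemBraidNat n k) ^ 2 = 1 := by
  unfold elemBraidNat
  split_ifs with h
  · have : braidToPerm n (elemBraid n ⟨k, h⟩) = adjSwap n ⟨k, h⟩ :=
      PresentedGroup.toGroup.of (adjSwap_rels n)
    rw [this, pow_two]
    exact Equiv.swap_mul_self _ _
  · simp

theorem pureGenBraid_mem (n : ℕ) (i j : Fin n) : pureGenBraid n i j ∈ PureBraid n := by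
  rw [MonoidHom.mem_ker, pureGenBraid, map_mul, map_mul, map_pow, braidToPerm_elemBraidNat_sq,
    map_inv, mul_one, mul_inv_cancel]

/-- `A_{i,j}` as an element of `P_n`, meant for `i < j`. -/
def pureGen (n : ℕ) (i j : Fin n) : PureBraid n := ⟨pureGenBraid n i j, pureGenBraid_mem n i j⟩

/-- `P_n` modulo its centre. -/
abbrev PureBraidBar (n : ℕ) : Type := PureBraid n ⧸ Subgroup.center (PureBraid n)

/-- The image of `A_{i,j}` in `P_n / Z(P_n)`, meant for `i < j`. -/
def pureGenBar (n : ℕ) (i j : Fin n) : PureBraidBar n := QuotientGroup.mk (pureGen n i j)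

/-! ### Lower central series and induced automorphisms -/

/-- The lower central series numbered from `1`: `Γ_1(G) = G`, `Γ_{i+1}(G) = [G, Γ_i(G)]`. -/
abbrev Gam (G : Type*) [Group G] (i : ℕ) : Subgroup G :=
  (⊤ : Subgroup G).lowerCentralSeries (i - 1)

/-- The quotient `Γ_i(G) / Γ_{i+1}(G)`. -/
abbrev GamQuot (G : Type*) [Group G] (i : ℕ) : Type _ :=
  Gam G i ⧸ (Gam G (i + 1)).subgroupOf (Gam G i)

/-- The automorphism of `G ⧸ N` induced by an automorphism of `G`, for `N` characteristic. -/
def autQuotient {G : Type*} [Group G] (N : Subgroup G) [N.Characteristic] :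
    MulAut G →* MulAut (G ⧸ N) where
  toFun f := QuotientGroup.congr N N f (Subgroup.characteristic_iff_map_eq.mp inferInstance f)
  map_one' := by
    ext x
    induction x using QuotientGroup.induction_on with
    | H g => rfl
  map_mul' f g := by
    ext x
    induction x using QuotientGroup.induction_on with
    | H g => rfl

theorem map_subgroupOf_characteristic {G : Type*} [Group G] (H K : Subgroup G) [H.Characteristic]
    [K.Characteristic] (f : MulAut G) :
    (K.subgroupOf H).map (MulAut.characteristic H f : H →* H) = K.subgroupOf H := by
  have key : ∀ f : MulAut G,
      (K.subgroupOf H).map (MulAut.characteristic H f : H →* H) ≤ K.subgroupOf H := by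
    rintro f _ ⟨x, hx, rfl⟩
    exact Subgroup.characteristic_iff_map_le.mp (inferInstance : K.Characteristic) f
      ⟨x.val, hx, rfl⟩
  refine le_antisymm (key f) fun x hx => ?_
  refine ⟨MulAut.characteristic H f⁻¹ x, key f⁻¹ ⟨x, hx, rfl⟩, ?_⟩
  apply Subtype.ext
  change f (f⁻¹ x.val) = x.val
  exact MulEquiv.apply_symm_apply f x.val

/-- The automorphism of `Γ_i(G) / Γ_{i+1}(G)` induced by an automorphism of `G`. -/
def autGamQuot (G : Type*) [Group G] (i : ℕ) : MulAut G →* MulAut (GamQuot G i) where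
  toFun f := QuotientGroup.congr _ _ (MulAut.characteristic (Gam G i) f)
    (map_subgroupOf_characteristic (Gam G i) (Gam G (i + 1)) f)
  map_one' := by
    ext x
    induction x using QuotientGroup.induction_on with
    | H g => rfl
  map_mul' f g := by
    ext x
    induction x using QuotientGroup.induction_on with
    | H g => rfl

/-- The homomorphism `φ_i` from `Aut(P_n)` to the automorphism group of
`Γ_i(P_n / Z(P_n)) / Γ_{i+1}(P_n / Z(P_n))`. -/
def braidPhi (n i : ℕ) : MulAut (PureBraid n) →* MulAut (GamQuot (PureBraidBar n) i) :=
  (autGamQuot (PureBraidBar n) i).comp (autQuotient (Subgroup.center (PureBraid n)))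

/-- The element `α_{r,s,t}` of `Γ_2(P_n / Z(P_n)) / Γ_3(P_n / Z(P_n))`: the class of the commutator
`[A_{r,s}, A_{s,t}] = A_{r,s} A_{s,t} A_{r,s}⁻¹ A_{s,t}⁻¹`, meant for `r < s < t`. -/
def alphaElt (n : ℕ) (r s t : Fin n) : GamQuot (PureBraidBar n) 2 :=
  QuotientGroup.mk
    (⟨⁅pureGenBar n r s, pureGenBar n s t⁆,
      Subgroup.commutator_mem_commutator (Subgroup.mem_top _) (Subgroup.mem_top _)⟩ :
      Gam (PureBraidBar n) 2)

/-- The automorphism `ω_k : x ↦ σ_k⁻¹ x σ_k` of `P_n`, where `0 ≤ k < n - 1`.  It sends `A_{i,j}` to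
a conjugate of `A_{τ_k(i), τ_k(j)}`.  Changing it by a central automorphism (one that is trivial on
`P_n / Z(P_n)`) does not change `φ_i(ω_k)`. -/
def braidOmega (n : ℕ) (k : Fin (n - 1)) : MulAut (PureBraid n) :=
  MulAut.conjNormal (elemBraid n k)⁻¹

/-- The subgroup of `Aut(Γ_2(P_n / Z(P_n)) / Γ_3(P_n / Z(P_n)))` generated by the automorphisms
`φ_2(ω_k)`, over all `0 ≤ k < n - 1`. -/
def omegaSubgroup (n : ℕ) : Subgroup (MulAut (GamQuot (PureBraidBar n) 2)) :=
  Subgroup.closure (Set.range fun k : Fin (n - 1) => braidPhi n 2 (braidOmega n k))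

/-! ### The commutator pairing with values in `Γ_2 / Γ_3` -/

section GamComm

variable {G : Type*} [Group G]

/-! The commutator induces an alternating bilinear pairing on the abelianization with values in
`Γ_2/Γ_3` (`gamComm_mul_left`, `gamComm_congr`), so `α_{r,s,t}` depends only on the classes of
`A_{r,s}` and `A_{s,t}` in the abelianization of `P_n`. Conjugation by a braid permutes the classes
of the `A_{i,j}` through the permutation of the braid (`abAct_pureGenSym`). Hence, with `α` extended
to all distinct triples, a braid acts on the `α`'s by permuting their indices (`braidAct_alphaSym`).
Reversing a triple inverts `α`; rotating it changes nothing, because the full twist on three strands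
commutes with their pure generators (`alphaSym_rotate`). These two symmetries produce the six cases.

Inner automorphisms act trivially on `Γ_2/Γ_3`, so the braid action factors through `S_n`, and its
image is the subgroup generated by the `φ_2(ω_k)` (`range_braidAct`). It remains to see that `S_n`
acts faithfully when `n ≥ 4` (`braidAct_eq_one_iff`). A nontrivial permutation moves some `r`; with
`s`, `t` chosen outside `r` and its image, `α_{r,s,t}` goes to an `α` whose first index is not in
`{r, s, t}`, and `alphaSym_ne` separates the two.

The separation uses the Burau representation at parameter `1 + X` over `ℤ⟦X⟧`. It is the permutation
representation modulo `X`, so it sends `Γ_k(P_n)` to matrices congruent to `1` modulo `X ^ k`, and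
`A_{i,j}` has first order term `1 - (i j)`. Leading terms of group commutators are ring commutators.
If the two `α`'s agreed, their difference would lie in `Γ_3(P_n)` up to a central factor; one
further commutator removes that factor and lands in `Γ_4`, yet the corresponding third order term
has an entry equal to `2`, which `X` does not divide. -/

theorem commutator_mem_gam_two (g h : G) : ⁅g, h⁆ ∈ Gam G 2 :=
  Subgroup.commutator_mem_commutator (Subgroup.mem_top _) (Subgroup.mem_top _)

theorem commutator_mem_gam_three {g : G} (hg : g ∈ Gam G 2) (h : G) : ⁅g, h⁆ ∈ Gam G 3 :=
  Subgroup.commutator_mem_commutator hg (Subgroup.mem_top _)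

/-- The class of the commutator `⁅g, h⁆` in `Γ_2(G) / Γ_3(G)`. -/
def gamComm (g h : G) : GamQuot G 2 :=
  QuotientGroup.mk (⟨⁅g, h⁆, commutator_mem_gam_two g h⟩ : Gam G 2)

theorem gamQuot_mk_eq_iff {a b : Gam G 2} :
    (QuotientGroup.mk a : GamQuot G 2) = QuotientGroup.mk b ↔ (a : G)⁻¹ * b ∈ Gam G 3 := by
  rw [QuotientGroup.eq]
  rfl

theorem gamComm_eq_iff {g h g' h' : G} :
    gamComm g h = gamComm g' h' ↔ ⁅g, h⁆⁻¹ * ⁅g', h'⁆ ∈ Gam G 3 :=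
  gamQuot_mk_eq_iff

theorem gamQuot_mul_comm (x y : GamQuot G 2) : x * y = y * x := by
  induction x using QuotientGroup.induction_on with
  | H a =>
    induction y using QuotientGroup.induction_on with
    | H b =>
      rw [← QuotientGroup.mk_mul, ← QuotientGroup.mk_mul, gamQuot_mk_eq_iff]
      have := commutator_mem_gam_three (inv_mem b.2) (a : G)⁻¹
      have h2 : (a * b : G)⁻¹ * (b * a) = ⁅(b : G)⁻¹, (a : G)⁻¹⁆ := by
        simp only [commutatorElement_def]; group
      exact (congrArg (· ∈ Gam G 3) h2).mpr this

theorem gamComm_inv (g h : G) : (gamComm g h)⁻¹ = gamComm h g := by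
  refine congrArg QuotientGroup.mk (Subtype.ext ?_)
  exact commutatorElement_inv g h

theorem gamComm_self (g : G) : gamComm g g = 1 :=
  congrArg QuotientGroup.mk (Subtype.ext (commutatorElement_self g))

theorem gamComm_eq_one_of_commute {g h : G} (hgh : Commute g h) : gamComm g h = 1 :=
  congrArg QuotientGroup.mk (Subtype.ext (commutatorElement_eq_one_iff_commute.mpr hgh))

theorem gamComm_eq_one_of_mem {g : G} (hg : g ∈ Gam G 2) (h : G) : gamComm g h = 1 :=
  (QuotientGroup.eq_one_iff _).mpr (commutator_mem_gam_three hg h)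

/-- Since `⁅g * g', h⁆ = g * ⁅g', h⁆ * g⁻¹ * ⁅g, h⁆`, the failure of additivity is a conjugate of a
commutator with an entry in `Γ_2`, hence lies in `Γ_3`. -/
theorem gamComm_mul_left (g g' h : G) : gamComm (g * g') h = gamComm g h * gamComm g' h := by
  rw [gamQuot_mul_comm]
  refine gamQuot_mk_eq_iff.mpr ?_
  have hm := inv_mem (commutator_mem_gam_three (inv_mem (commutator_mem_gam_two g' h)) g)
  have key : ⁅g * g', h⁆⁻¹ * (⁅g', h⁆ * ⁅g, h⁆) =
      ⁅g, h⁆⁻¹ * ⁅⁅g', h⁆⁻¹, g⁆⁻¹ * ⁅g, h⁆⁻¹⁻¹ := by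
    simp only [commutatorElement_def]; group
  change ⁅g * g', h⁆⁻¹ * (⁅g', h⁆ * ⁅g, h⁆) ∈ Gam G 3
  rw [key]
  exact Subgroup.Normal.conj_mem inferInstance _ hm _

theorem gamComm_mul_right (g h h' : G) : gamComm g (h * h') = gamComm g h * gamComm g h' := by
  rw [← gamComm_inv, gamComm_mul_left, mul_inv_rev, gamComm_inv, gamComm_inv, gamQuot_mul_comm]

theorem gamComm_congr_left {g g' : G} (h : G) (hg : Abelianization.of g = Abelianization.of g') :
    gamComm g h = gamComm g' h := by
  have hm : g⁻¹ * g' ∈ Gam G 2 := QuotientGroup.eq.mp hg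
  have := gamComm_mul_left g (g⁻¹ * g') h
  rwa [mul_inv_cancel_left, gamComm_eq_one_of_mem hm, mul_one, eq_comm] at this

theorem gamComm_congr {g g' h h' : G} (hg : Abelianization.of g = Abelianization.of g')
    (hh : Abelianization.of h = Abelianization.of h') : gamComm g h = gamComm g' h' := by
  rw [gamComm_congr_left h hg, ← gamComm_inv, gamComm_congr_left g' hh, gamComm_inv]

theorem autGamQuot_gamComm (f : MulAut G) (g h : G) :
    autGamQuot G 2 f (gamComm g h) = gamComm (f g) (f h) :=
  congrArg QuotientGroup.mk (Subtype.ext (map_commutatorElement f g h))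

/-- Conjugation by `g` changes an element of `Γ_2` only by its commutator with `g`, which lies in
`Γ_3`. -/
theorem autGamQuot_conj (g : G) : autGamQuot G 2 (MulAut.conj g) = 1 := by
  ext x
  induction x using QuotientGroup.induction_on with
  | H a =>
    refine gamQuot_mk_eq_iff.mpr ?_
    change (g * (a : G) * g⁻¹)⁻¹ * a ∈ Gam G 3
    have h1 : (g * (a : G) * g⁻¹)⁻¹ * a = ((a : G)⁻¹ * ⁅(a : G), g⁆ * (a : G)⁻¹⁻¹) := by
      simp only [commutatorElement_def]; group
    rw [h1]
    exact Subgroup.Normal.conj_mem inferInstance _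
      (commutator_mem_gam_three a.2 g) _

end GamComm

/-! ### Conjugation of the pure generators modulo commutators -/

/-- Operators `T k` satisfying the relations of the adjacent transpositions move a family `a i j`,
`i < j`, like the transpositions move pairs, as soon as this holds for the defining moves. -/
theorem adjacent_action_on_pairs {Y : Type*} {N : ℕ} {T : ℕ → Y → Y} {a : ℕ → ℕ → Y}
    (hinv : ∀ k y, T k (T k y) = y)
    (hfar : ∀ i j y, i + 2 ≤ j → T i (T j y) = T j (T i y))
    (hbraid : ∀ k y, k + 2 < N → T (k + 1) (T k (T (k + 1) y)) = T k (T (k + 1) (T k y)))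
    (hself : ∀ i, T i (a i (i + 1)) = a i (i + 1))
    (hfarself : ∀ i k, i + 2 ≤ k ∨ k + 2 ≤ i → T k (a i (i + 1)) = a i (i + 1))
    (hstep : ∀ i j, i < j → T j (a i j) = a i (j + 1))
    (hshift : ∀ i, i + 2 < N → T i (T (i + 1) (a i (i + 1))) = a (i + 1) (i + 2))
    {i j k : ℕ} (hij : i < j) (hj : j < N) :
    ((k + 1 < i ∨ (k = i ∧ j = i + 1) ∨ (i < k ∧ k + 1 < j) ∨ j < k) → T k (a i j) = a i j) ∧
    (k + 1 = i → T k (a i j) = a k j) ∧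
    (k = i → i + 1 < j → T k (a i j) = a (i + 1) j) ∧
    (k + 1 = j → i < k → T k (a i j) = a i k) ∧
    (k = j → T k (a i j) = a i (j + 1)) := by
  have hlow : ∀ d i k, k + 1 < i → T k (a i (i + 1 + d)) = a i (i + 1 + d) := by
    intro d
    induction d with
    | zero => intro i k hk; exact hfarself i k (by omega)
    | succ d ih =>
      intro i k hk
      rw [← add_assoc, ← hstep i (i + 1 + d) (by omega), hfar _ _ _ (by omega), ih i k hk]
  have hhigh : ∀ d i k, i + 1 + d < k → T k (a i (i + 1 + d)) = a i (i + 1 + d) := by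
    intro d
    induction d with
    | zero => intro i k hk; exact hfarself i k (by omega)
    | succ d ih =>
      intro i k hk
      rw [← add_assoc, ← hstep i (i + 1 + d) (by omega), ← hfar _ _ _ (by omega),
        ih i k (by omega)]
  have hleft : ∀ d i, i + 2 + d < N → T i (a i (i + 2 + d)) = a (i + 1) (i + 2 + d) := by
    intro d
    induction d with
    | zero => intro i hi; rw [← hshift i (by omega), hstep i (i + 1) (by omega)]
    | succ d ih =>
      intro i hi
      rw [← add_assoc, ← hstep i (i + 2 + d) (by omega), hfar _ _ _ (by omega), ih i (by omega),
        hstep (i + 1) (i + 2 + d) (by omega)]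
  have hmid : ∀ d i k, i < k → k + 2 + d < N → T k (a i (k + 2 + d)) = a i (k + 2 + d) := by
    intro d
    induction d with
    | zero =>
      intro i k hik hk
      -- Here `T k` crosses strands strictly between `i` and `j`. The braid relation moves it past
      -- `T (k + 1)` and `T k`, where it becomes `T (k + 1)` acting on `a i k`, a case already
      -- settled by `hhigh`.
      have h1 : a i (k + 2) = T (k + 1) (T k (a i k)) := by
        rw [hstep i k hik, hstep i (k + 1) (by omega)]
      obtain ⟨e, rfl⟩ : ∃ e, k = i + 1 + e := ⟨k - (i + 1), by omega⟩
      rw [add_zero, h1, ← hbraid _ _ (by omega), hhigh e i _ (by omega)]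
    | succ d ih =>
      intro i k hik hk
      rw [← add_assoc, ← hstep i (k + 2 + d) (by omega), hfar _ _ _ (by omega),
        ih i k hik (by omega)]
  refine ⟨?_, ?_, ?_, ?_, ?_⟩
  · rintro (h | ⟨rfl, rfl⟩ | ⟨h, h'⟩ | h)
    · obtain ⟨d, rfl⟩ : ∃ d, j = i + 1 + d := ⟨j - (i + 1), by omega⟩
      exact hlow d i k h
    · exact hself k
    · obtain ⟨d, rfl⟩ : ∃ d, j = k + 2 + d := ⟨j - (k + 2), by omega⟩
      exact hmid d i k h hj
    · obtain ⟨d, rfl⟩ : ∃ d, j = i + 1 + d := ⟨j - (i + 1), by omega⟩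
      exact hhigh d i k h
  · rintro rfl
    obtain ⟨d, rfl⟩ : ∃ d, j = k + 2 + d := ⟨j - (k + 2), by omega⟩
    rw [← hleft d k hj, hinv]
  · rintro rfl h
    obtain ⟨d, rfl⟩ : ∃ d, j = k + 2 + d := ⟨j - (k + 2), by omega⟩
    exact hleft d k hj
  · rintro rfl h
    rw [← hstep i k h, hinv]
  · rintro rfl
    exact hstep i k hij

/-! ### Relations and generation in the braid group -/

theorem braidToPerm_elemBraid (n : ℕ) (k : Fin (n - 1)) :
    braidToPerm n (elemBraid n k) = adjSwap n k :=
  PresentedGroup.toGroup.of (adjSwap_rels n)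

theorem elemBraidNat_of_lt {n k : ℕ} (h : k < n - 1) : elemBraidNat n k = elemBraid n ⟨k, h⟩ :=
  dif_pos h

/-- No upper bound on `j` is required, since the default value out of range is `1`. -/
theorem elemBraidNat_far (n : ℕ) {i j : ℕ} (hij : i + 2 ≤ j) :
    Commute (elemBraidNat n i) (elemBraidNat n j) := by
  by_cases hj : j < n - 1
  · rw [elemBraidNat_of_lt hj, elemBraidNat_of_lt (show i < n - 1 by omega)]
    have := PresentedGroup.one_of_mem (rels := braidRels n)
      (Or.inl ⟨⟨i, by omega⟩, ⟨j, hj⟩, hij, rfl⟩)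
    rw [map_mul, map_inv, mul_inv_eq_one, map_mul, map_mul] at this
    exact this
  · rw [show elemBraidNat n j = 1 from dif_neg hj]
    exact Commute.one_right _

/-- Here the bound matters: at `k = n - 2` the default value `1` would turn the relation into `σ_k =
σ_k ^ 2`. -/
theorem elemBraidNat_braid {n k : ℕ} (hk : k + 2 < n) :
    elemBraidNat n (k + 1) * elemBraidNat n k * elemBraidNat n (k + 1) =
      elemBraidNat n k * elemBraidNat n (k + 1) * elemBraidNat n k := by
  rw [elemBraidNat_of_lt (show k < n - 1 by omega),
    elemBraidNat_of_lt (show k + 1 < n - 1 by omega)]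
  have := PresentedGroup.one_of_mem (rels := braidRels n)
    (Or.inr ⟨⟨k, by omega⟩, ⟨k + 1, by omega⟩, rfl, rfl⟩)
  rw [map_mul, map_inv, mul_inv_eq_one, map_mul, map_mul, map_mul, map_mul] at this
  exact this

theorem Braid.induction {n : ℕ} {p : Braid n → Prop} (one : p 1)
    (of : ∀ k : Fin (n - 1), p (elemBraid n k)) (mul : ∀ b c, p b → p c → p (b * c))
    (inv : ∀ b, p b → p b⁻¹) (b : Braid n) : p b := by
  have hb : b ∈ Subgroup.closure (Set.range (PresentedGroup.of (rels := braidRels n))) := by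
    rw [PresentedGroup.closure_range_of]
    exact Subgroup.mem_top b
  induction hb using Subgroup.closure_induction with
  | mem x hx =>
    obtain ⟨k, rfl⟩ := hx
    exact of k
  | one => exact one
  | mul x y _ _ hx hy => exact mul x y hx hy
  | inv x _ hx => exact inv x hx

theorem braidToPerm_surjective (n : ℕ) : Function.Surjective (braidToPerm n) := by
  rw [← MonoidHom.range_eq_top, eq_top_iff]
  cases n with
  | zero => intro π _; exact ⟨1, Subsingleton.elim _ _⟩
  | succ m =>
    intro π _
    have hπ : π ∈ Submonoid.closure (Set.range fun i : Fin m => Equiv.swap i.castSucc i.succ) := by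
      rw [Equiv.Perm.mclosure_swap_castSucc_succ]
      exact Submonoid.mem_top π
    refine (Submonoid.closure_le (S := (braidToPerm (m + 1)).range.toSubmonoid)).mpr ?_ hπ
    rintro _ ⟨i, rfl⟩
    exact ⟨elemBraid (m + 1) i, braidToPerm_elemBraid (m + 1) i⟩

/-- `A_{i,j}` for natural numbers `i < j`. -/
def pureGenNat (n i j : ℕ) : Braid n :=
  ((List.range' (i + 1) (j - (i + 1))).reverse.map (elemBraidNat n)).prod *
    elemBraidNat n i ^ 2 *
    ((List.range' (i + 1) (j - (i + 1))).reverse.map (elemBraidNat n)).prod⁻¹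

theorem pureGenNat_mem (n i j : ℕ) : pureGenNat n i j ∈ PureBraid n := by
  rw [MonoidHom.mem_ker, pureGenNat, map_mul, map_mul, map_pow, braidToPerm_elemBraidNat_sq,
    map_inv, mul_one, mul_inv_cancel]

theorem pureGenNat_self_succ (n i : ℕ) : pureGenNat n i (i + 1) = elemBraidNat n i ^ 2 := by
  simp [pureGenNat]

theorem pureGenNat_succ (n : ℕ) {i j : ℕ} (hij : i < j) :
    pureGenNat n i (j + 1) = elemBraidNat n j * pureGenNat n i j * (elemBraidNat n j)⁻¹ := by
  have h1 : List.range' (i + 1) (j + 1 - (i + 1)) =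
      List.range' (i + 1) (j - (i + 1)) ++ [j] := by
    rw [show j + 1 - (i + 1) = j - (i + 1) + 1 by omega, List.range'_1_concat,
      show i + 1 + (j - (i + 1)) = j by omega]
  rw [pureGenNat, h1, pureGenNat]
  simp only [List.reverse_append, List.map_append, List.reverse_singleton, List.map_singleton,
    List.prod_append, List.prod_singleton]
  group

/-- The action of a braid on the abelianization of the pure braid group by conjugation. -/
def abAct (n : ℕ) (b : Braid n) :
    Abelianization (PureBraid n) →* Abelianization (PureBraid n) :=
  Abelianization.map (MulAut.conjNormal b : MulAut (PureBraid n)).toMonoidHom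

theorem abAct_of (n : ℕ) (b : Braid n) (p : PureBraid n) :
    abAct n b (Abelianization.of p) = Abelianization.of (MulAut.conjNormal b p) :=
  rfl

theorem abAct_mul (n : ℕ) (b c : Braid n) (y : Abelianization (PureBraid n)) :
    abAct n (b * c) y = abAct n b (abAct n c y) := by
  induction y using QuotientGroup.induction_on with
  | H p =>
    change abAct n (b * c) (Abelianization.of p) = abAct n b (abAct n c (Abelianization.of p))
    rw [abAct_of, abAct_of, abAct_of, map_mul, MulAut.mul_apply]

/-- A pure braid acts by an inner automorphism, which is invisible in the abelianization. -/
theorem abAct_of_mem (n : ℕ) {b : Braid n} (hb : b ∈ PureBraid n)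
    (y : Abelianization (PureBraid n)) : abAct n b y = y := by
  induction y using QuotientGroup.induction_on with
  | H p =>
    change abAct n b (Abelianization.of p) = Abelianization.of p
    have h : (MulAut.conjNormal b p : PureBraid n) = ⟨b, hb⟩ * p * ⟨b, hb⟩⁻¹ := Subtype.ext rfl
    rw [abAct_of, h, map_mul, map_mul, map_inv, mul_comm, inv_mul_cancel_left]

/-- The class of `A_{i,j}` in the abelianization of the pure braid group. -/
def pureGenNatAb (n i j : ℕ) : Abelianization (PureBraid n) :=
  Abelianization.of ⟨pureGenNat n i j, pureGenNat_mem n i j⟩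

theorem abAct_eq_of_conj (n : ℕ) {b : Braid n} {i j i' j' : ℕ}
    (h : b * pureGenNat n i j * b⁻¹ = pureGenNat n i' j') :
    abAct n b (pureGenNatAb n i j) = pureGenNatAb n i' j' :=
  congrArg Abelianization.of (Subtype.ext h)

/-- Because `σ_k ^ 2` is pure, each `σ_k` acts as an involution, so `adjacent_action_on_pairs`
applies. This avoids computing the exact conjugates of `A_{i,j}` in `P_n`. -/
theorem abAct_pureGenNatAb (n : ℕ) {i j : ℕ} (k : ℕ) (hij : i < j) (hj : j < n) :
    let T := abAct n (elemBraidNat n k)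
    let a := pureGenNatAb n
    ((k + 1 < i ∨ (k = i ∧ j = i + 1) ∨ (i < k ∧ k + 1 < j) ∨ j < k) → T (a i j) = a i j) ∧
    (k + 1 = i → T (a i j) = a k j) ∧
    (k = i → i + 1 < j → T (a i j) = a (i + 1) j) ∧
    (k + 1 = j → i < k → T (a i j) = a i k) ∧
    (k = j → T (a i j) = a i (j + 1)) := by
  refine adjacent_action_on_pairs (N := n) (T := fun k => abAct n (elemBraidNat n k)) ?_ ?_ ?_ ?_
    ?_ ?_ ?_ hij hj
  · intro k y
    rw [← abAct_mul]
    refine abAct_of_mem n ?_ y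
    rw [MonoidHom.mem_ker, ← pow_two, map_pow, braidToPerm_elemBraidNat_sq]
  · intro i j y h
    simp only [← abAct_mul, (elemBraidNat_far n h).eq]
  · intro k y hk
    simp only [← abAct_mul, ← mul_assoc, elemBraidNat_braid hk]
  · intro i
    apply abAct_eq_of_conj
    rw [pureGenNat_self_succ]
    group
  · intro i k h
    apply abAct_eq_of_conj
    rw [pureGenNat_self_succ]
    have hc : Commute (elemBraidNat n k) (elemBraidNat n i) := by
      rcases h with h | h
      · exact (elemBraidNat_far n h).symm
      · exact elemBraidNat_far n h
    rw [(hc.pow_right 2).eq, mul_inv_cancel_right]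
  · intro i j h
    apply abAct_eq_of_conj
    rw [pureGenNat_succ n h]
  -- Two uses of the braid relation show that `σ_i σ_{i+1}` conjugates `σ_i ^ 2` to `σ_{i+1} ^ 2`.
  · intro i hi
    rw [← abAct_mul]
    apply abAct_eq_of_conj
    rw [pureGenNat_self_succ, pureGenNat_self_succ, mul_inv_eq_iff_eq_mul, pow_two, pow_two,
      ← mul_assoc, ← elemBraidNat_braid hi, mul_assoc, mul_assoc, mul_assoc]
    congr 1
    rw [← mul_assoc, ← mul_assoc, elemBraidNat_braid hi]

/-- `A_{i,j}` for `i ≠ j`, with the indices put into increasing order. -/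
def pureGenSym (n : ℕ) (i j : Fin n) : PureBraid n := pureGen n (min i j) (max i j)

theorem pureGenSym_comm (n : ℕ) (i j : Fin n) : pureGenSym n i j = pureGenSym n j i := by
  rw [pureGenSym, min_comm, max_comm, pureGenSym]

theorem pureGenSym_of_lt {n : ℕ} {i j : Fin n} (h : i < j) :
    pureGenSym n i j = pureGen n i j := by
  rw [pureGenSym, min_eq_left h.le, max_eq_right h.le]

theorem of_pureGenSym_of_lt {n : ℕ} {i j : Fin n} (h : i < j) :
    Abelianization.of (pureGenSym n i j) = pureGenNatAb n i j := by
  rw [pureGenSym_of_lt h]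
  rfl

theorem abAct_elemBraid_pureGenSym (n : ℕ) (k : Fin (n - 1)) {i j : Fin n} (hij : i < j) :
    abAct n (elemBraid n k) (Abelianization.of (pureGenSym n i j)) =
      Abelianization.of (pureGenSym n (adjSwap n k i) (adjSwap n k j)) := by
  obtain ⟨k, hk⟩ := k
  obtain ⟨i, hi⟩ := i
  obtain ⟨j, hj⟩ := j
  have hij' : i < j := hij
  obtain ⟨h1, h2, h3, h4, h5⟩ := abAct_pureGenNatAb n k hij' hj
  rw [of_pureGenSym_of_lt hij, ← elemBraidNat_of_lt hk]
  have hne : ∀ {m : ℕ} (hm : m < n), m ≠ k → m ≠ k + 1 →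
      adjSwap n ⟨k, hk⟩ ⟨m, hm⟩ = ⟨m, hm⟩ := fun hm h h' =>
    Equiv.swap_apply_of_ne_of_ne (by simpa using h) (by simpa using h')
  have hl : ∀ h : k < n, adjSwap n ⟨k, hk⟩ ⟨k, h⟩ = ⟨k + 1, by omega⟩ := fun h =>
    Equiv.swap_apply_left _ _
  have hr : ∀ h : k + 1 < n, adjSwap n ⟨k, hk⟩ ⟨k + 1, h⟩ = ⟨k, by omega⟩ := fun h =>
    Equiv.swap_apply_right _ _
  rcases Nat.lt_trichotomy k i with hki | rfl | hki
  · rcases Nat.lt_or_ge (k + 1) i with h | h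
    · rw [hne hi (by omega) (by omega), hne hj (by omega) (by omega), of_pureGenSym_of_lt hij]
      exact h1 (Or.inl h)
    · obtain rfl : k + 1 = i := by omega
      rw [hr, hne hj (by omega) (by omega), of_pureGenSym_of_lt (Fin.mk_lt_mk.mpr (by omega))]
      exact h2 rfl
  · rw [hl]
    rcases Nat.lt_or_ge (k + 1) j with h | h
    · rw [hne hj (by omega) (by omega), of_pureGenSym_of_lt (Fin.mk_lt_mk.mpr (by omega))]
      exact h3 rfl h
    · obtain rfl : k + 1 = j := by omega
      rw [hr, pureGenSym_comm, of_pureGenSym_of_lt (Fin.mk_lt_mk.mpr (by omega))]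
      exact h1 (by omega)
  · rw [hne hi (by omega) (by omega)]
    rcases Nat.lt_trichotomy k j with hkj | rfl | hkj
    · rcases Nat.lt_or_ge (k + 1) j with h | h
      · rw [hne hj (by omega) (by omega), of_pureGenSym_of_lt hij]
        exact h1 (by omega)
      · obtain rfl : k + 1 = j := by omega
        rw [hr, of_pureGenSym_of_lt (Fin.mk_lt_mk.mpr (by omega))]
        exact h4 rfl hki
    · rw [hl, of_pureGenSym_of_lt (Fin.mk_lt_mk.mpr (by omega))]
      exact h5 rfl
    · rw [hne hj (by omega) (by omega), of_pureGenSym_of_lt hij]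
      exact h1 (by omega)

theorem abAct_pureGenSym (n : ℕ) (b : Braid n) : ∀ i j : Fin n, i ≠ j →
    abAct n b (Abelianization.of (pureGenSym n i j)) =
      Abelianization.of (pureGenSym n (braidToPerm n b i) (braidToPerm n b j)) := by
  induction b using Braid.induction with
  | one =>
    intro i j _
    rw [abAct_of_mem n (one_mem _), map_one, Equiv.Perm.one_apply, Equiv.Perm.one_apply]
  | of k =>
    intro i j hij
    rw [braidToPerm_elemBraid]
    rcases hij.lt_or_gt with h | h
    · exact abAct_elemBraid_pureGenSym n k h
    · rw [pureGenSym_comm, abAct_elemBraid_pureGenSym n k h, pureGenSym_comm]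
  | mul b c hb hc =>
    intro i j hij
    rw [abAct_mul, hc i j hij, hb _ _ ((braidToPerm n c).injective.ne hij), map_mul,
      Equiv.Perm.mul_apply, Equiv.Perm.mul_apply]
  | inv b hb =>
    intro i j hij
    -- The induction hypothesis is taken at the preimages of `i` and `j`, and then `b⁻¹` is applied
    -- to it.
    have h := hb _ _ ((braidToPerm n b)⁻¹.injective.ne hij)
    simp only [← Equiv.Perm.mul_apply, mul_inv_cancel, Equiv.Perm.one_apply] at h
    rw [← h, ← abAct_mul, inv_mul_cancel, abAct_of_mem n (one_mem _), map_inv]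

/-! ### The braid action on `Γ_2 / Γ_3` -/

/-- The action of a braid on `Γ_2(P_n / Z(P_n)) / Γ_3(P_n / Z(P_n))` by conjugation. -/
def braidAct (n : ℕ) : Braid n →* MulAut (GamQuot (PureBraidBar n) 2) :=
  (braidPhi n 2).comp MulAut.conjNormal

/-- The class of `⁅g, h⁆` in `Γ_2(P_n / Z(P_n)) / Γ_3(P_n / Z(P_n))`. -/
def pureComm (n : ℕ) (g h : PureBraid n) : GamQuot (PureBraidBar n) 2 :=
  gamComm (g : PureBraidBar n) (h : PureBraidBar n)

theorem pureComm_mul_right (n : ℕ) (g h h' : PureBraid n) :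
    pureComm n g (h * h') = pureComm n g h * pureComm n g h' :=
  gamComm_mul_right (G := PureBraidBar n) (g : PureBraidBar n) (h : PureBraidBar n)
    (h' : PureBraidBar n)

theorem braidAct_pureComm (n : ℕ) (b : Braid n) (g h : PureBraid n) :
    braidAct n b (pureComm n g h) =
      pureComm n (MulAut.conjNormal b g) (MulAut.conjNormal b h) :=
  autGamQuot_gamComm _ _ _

/-- Lets computations in the abelianization of `P_n` itself be used for the pairing on the quotient
by the centre. -/
theorem pureComm_congr {n : ℕ} {g g' h h' : PureBraid n}
    (hg : Abelianization.of g = Abelianization.of g')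
    (hh : Abelianization.of h = Abelianization.of h') : pureComm n g h = pureComm n g' h' := by
  have key : ∀ {x y : PureBraid n}, Abelianization.of x = Abelianization.of y →
      Abelianization.of (x : PureBraidBar n) = Abelianization.of (y : PureBraidBar n) :=
    fun h => congrArg
      (Abelianization.map (QuotientGroup.mk' (Subgroup.center (PureBraid n)))) h
  exact gamComm_congr (key hg) (key hh)

theorem braidAct_of_mem (n : ℕ) {b : Braid n} (hb : b ∈ PureBraid n) : braidAct n b = 1 := by
  have h : autQuotient (Subgroup.center (PureBraid n)) (MulAut.conjNormal b) =
      MulAut.conj ((⟨b, hb⟩ : PureBraid n) : PureBraidBar n) := by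
    ext x
    induction x using QuotientGroup.induction_on with
    | H p => rfl
  change autGamQuot _ 2 (autQuotient _ (MulAut.conjNormal b)) = 1
  rw [h, autGamQuot_conj]

/-- `α_{r,s,t}` for arbitrary distinct indices, as the class of `⁅A_{r,s}, A_{s,t}⁆`. -/
def alphaSym (n : ℕ) (r s t : Fin n) : GamQuot (PureBraidBar n) 2 :=
  pureComm n (pureGenSym n r s) (pureGenSym n s t)

theorem alphaSym_of_lt {n : ℕ} {r s t : Fin n} (h : r < s) (h' : s < t) :
    alphaSym n r s t = alphaElt n r s t := by
  rw [alphaSym, pureGenSym_of_lt h, pureGenSym_of_lt h']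
  rfl

theorem alphaSym_reverse (n : ℕ) (r s t : Fin n) : alphaSym n t s r = (alphaSym n r s t)⁻¹ := by
  rw [alphaSym, alphaSym, pureGenSym_comm n t s, pureGenSym_comm n s r]
  exact (gamComm_inv _ _).symm

theorem braidAct_alphaSym (n : ℕ) (b : Braid n) {r s t : Fin n} (hrs : r ≠ s) (hst : s ≠ t) :
    braidAct n b (alphaSym n r s t) =
      alphaSym n (braidToPerm n b r) (braidToPerm n b s) (braidToPerm n b t) := by
  rw [alphaSym, braidAct_pureComm]
  apply pureComm_congr
  · rw [← abAct_of, abAct_pureGenSym n b r s hrs]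
  · rw [← abAct_of, abAct_pureGenSym n b s t hst]

/-- With `x = A_{0,1}`, `y = A_{1,2}`, `z = A_{0,2}`, the product `z * y * x` is the full twist
`(σ_1 σ_0) ^ 3` on the first three strands and commutes with `y`. Bilinearity turns this into `⁅y,
z⁆ ⁅y, x⁆ = 1` in `Γ_2/Γ_3`. -/
theorem alphaSym_rotate_zero (n : ℕ) (hn : 3 ≤ n) :
    alphaSym n ⟨0, by omega⟩ ⟨1, by omega⟩ ⟨2, by omega⟩ =
      alphaSym n ⟨1, by omega⟩ ⟨2, by omega⟩ ⟨0, by omega⟩ := by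
  set x := pureGenSym n ⟨0, by omega⟩ ⟨1, by omega⟩ with hx
  set y := pureGenSym n ⟨1, by omega⟩ ⟨2, by omega⟩ with hy
  set z := pureGenSym n ⟨0, by omega⟩ ⟨2, by omega⟩ with hz
  have hx' : (x : Braid n) = elemBraidNat n 0 ^ 2 := by
    rw [hx, pureGenSym_of_lt (Fin.mk_lt_mk.mpr (by omega))]
    exact pureGenNat_self_succ n 0
  have hy' : (y : Braid n) = elemBraidNat n 1 ^ 2 := by
    rw [hy, pureGenSym_of_lt (Fin.mk_lt_mk.mpr (by omega))]
    exact pureGenNat_self_succ n 1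
  have hz' : (z : Braid n) = elemBraidNat n 1 * elemBraidNat n 0 ^ 2 * (elemBraidNat n 1)⁻¹ := by
    rw [hz, pureGenSym_of_lt (Fin.mk_lt_mk.mpr (by omega))]
    change pureGenNat n 0 (1 + 1) = _
    rw [pureGenNat_succ n Nat.zero_lt_one, ← pureGenNat_self_succ]
  have hc : Commute y (z * y * x) := by
    have hb : elemBraidNat n 1 * elemBraidNat n 0 * elemBraidNat n 1 =
      elemBraidNat n 0 * elemBraidNat n 1 * elemBraidNat n 0 := elemBraidNat_braid (by omega)
    have hp : ((z * y * x : PureBraid n) : Braid n) =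
        (elemBraidNat n 1 * elemBraidNat n 0) ^ 3 := by
      rw [Subgroup.coe_mul, Subgroup.coe_mul, hx', hy', hz']
      generalize elemBraidNat n 1 = a at *
      generalize elemBraidNat n 0 = b at *
      calc a * b ^ 2 * a⁻¹ * a ^ 2 * b ^ 2 = a * b * (b * a * b) * b := by
            simp only [pow_two]; group
        _ = (a * b) ^ 3 := by rw [← hb]; simp only [pow_succ, pow_zero, one_mul, mul_assoc]
    have h1 : Commute (elemBraidNat n 1) ((elemBraidNat n 1 * elemBraidNat n 0) ^ 3) := by
      generalize elemBraidNat n 1 = a at *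
      generalize elemBraidNat n 0 = b at *
      change a * (a * b) ^ 3 = (a * b) ^ 3 * a
      calc a * (a * b) ^ 3 = a * ((a * b * a) * (b * a * b)) := by
            simp only [pow_succ, pow_zero, one_mul, mul_assoc]
        _ = a * ((b * a * b) * (a * b * a)) := by rw [hb]
        _ = (a * b) ^ 3 * a := by simp only [pow_succ, pow_zero, one_mul, mul_assoc]
    apply Subtype.ext
    change (y : Braid n) * ((z * y * x : PureBraid n) : Braid n) =
      ((z * y * x : PureBraid n) : Braid n) * y
    rw [hp, hy']
    exact h1.pow_left 2
  have h1 : pureComm n y (z * y * x) = 1 :=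
    gamComm_eq_one_of_commute (G := PureBraidBar n)
      (hc.map (QuotientGroup.mk' (Subgroup.center (PureBraid n))))
  have h2 : pureComm n y (z * y * x) = pureComm n y z * pureComm n y y * pureComm n y x := by
    rw [pureComm_mul_right, pureComm_mul_right]
  have h3 : pureComm n y y = 1 := gamComm_self _
  rw [h1, h3, mul_one, eq_comm] at h2
  replace h2 := eq_inv_of_mul_eq_one_left h2
  have h4 : (pureComm n y x)⁻¹ = pureComm n x y := gamComm_inv _ _
  rw [h4] at h2
  rw [alphaSym, alphaSym, pureGenSym_comm n ⟨2, _⟩ ⟨0, _⟩]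
  exact h2.symm

theorem exists_braid_three {n : ℕ} (hn : 3 ≤ n) {r s t : Fin n} (hrs : r ≠ s) (hst : s ≠ t)
    (hrt : r ≠ t) : ∃ b : Braid n, braidToPerm n b ⟨0, by omega⟩ = r ∧
      braidToPerm n b ⟨1, by omega⟩ = s ∧ braidToPerm n b ⟨2, by omega⟩ = t := by
  have hinj : ∀ {a b c : Fin n}, a ≠ b → b ≠ c → a ≠ c → Function.Injective ![a, b, c] := by
    intro a b c h1 h2 h3 i j hij
    fin_cases i <;> fin_cases j <;> simp_all
  obtain ⟨π, hπ⟩ := Equiv.Perm.exists_extending_pair _ _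
    (hinj (a := ⟨0, by omega⟩) (b := ⟨1, by omega⟩) (c := ⟨2, by omega⟩) (by simp) (by simp)
      (by simp)) (hinj hrs hst hrt)
  obtain ⟨b, rfl⟩ := braidToPerm_surjective n π
  exact ⟨b, hπ 0, hπ 1, hπ 2⟩

/-- The braid action is transitive on triples of distinct indices, so the case of the first three
strands is enough. -/
theorem alphaSym_rotate {n : ℕ} {r s t : Fin n} (hrs : r ≠ s) (hst : s ≠ t)
    (hrt : r ≠ t) : alphaSym n r s t = alphaSym n s t r := by
  have hn : 3 ≤ n := by omega
  obtain ⟨b, rfl, rfl, rfl⟩ := exists_braid_three hn hrs hst hrt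
  rw [← braidAct_alphaSym n b (by simp) (by simp), alphaSym_rotate_zero n hn,
    braidAct_alphaSym n b (by simp) (by simp)]

/-- The six cases for a permutation acting on `α_{r,s,t}`. -/
theorem alphaSym_cases {n : ℕ} {x y z : Fin n} (hxy : x ≠ y) (hyz : y ≠ z) (hxz : x ≠ z) :
    (x < y → y < z → alphaSym n x y z = alphaElt n x y z) ∧
    (y < z → z < x → alphaSym n x y z = alphaElt n y z x) ∧
    (z < x → x < y → alphaSym n x y z = alphaElt n z x y) ∧
    (x < z → z < y → alphaSym n x y z = (alphaElt n x z y)⁻¹) ∧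
    (y < x → x < z → alphaSym n x y z = (alphaElt n y x z)⁻¹) ∧
    (z < y → y < x → alphaSym n x y z = (alphaElt n z y x)⁻¹) := by
  have h1 := alphaSym_rotate hxy hyz hxz
  have h2 := alphaSym_rotate hyz hxz.symm hxy.symm
  refine ⟨?_, ?_, ?_, ?_, ?_, ?_⟩ <;> intro h h'
  · exact alphaSym_of_lt h h'
  · rw [h1, alphaSym_of_lt h h']
  · rw [h1, h2, alphaSym_of_lt h h']
  · rw [h1, ← alphaSym_of_lt h h', alphaSym_reverse]
  · rw [h1, h2, ← alphaSym_of_lt h h', ← alphaSym_reverse]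
  · rw [← alphaSym_of_lt h h', ← alphaSym_reverse]

/-! ### Units congruent to `1` modulo powers of a central element -/

section Congruence

variable {R S : Type*} [CommRing R] [Ring S] [Algebra R S] (ε : R)

/-- The group of units congruent to `1` modulo `ε ^ k`. -/
def congrUnits (S : Type*) [Ring S] [Algebra R S] (k : ℕ) : Subgroup Sˣ where
  carrier := {u | ∃ N : S, (u : S) = 1 + ε ^ k • N}
  one_mem' := ⟨0, by simp⟩
  mul_mem' := by
    rintro u v ⟨M, hM⟩ ⟨N, hN⟩
    refine ⟨M + N + ε ^ k • (M * N), ?_⟩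
    rw [Units.val_mul, hM, hN]
    simp only [mul_add, add_mul, one_mul, mul_one, smul_mul_assoc, mul_smul_comm, smul_add]
    abel
  inv_mem' := by
    rintro u ⟨M, hM⟩
    refine ⟨-((u⁻¹ : Sˣ) * M : S), ?_⟩
    have h : (u⁻¹ : Sˣ) * (u : S) = 1 := u.inv_mul
    rw [hM, mul_add, mul_one, mul_smul_comm] at h
    rw [smul_neg, ← h]
    abel

variable {ε}

variable (ε) in
/-- `u` is congruent to `1 + ε ^ k M` modulo `ε ^ (k + 1)`. -/
def HasLead (k : ℕ) (u : Sˣ) (M : S) : Prop :=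
  ∃ N : S, (u : S) = 1 + ε ^ k • M + ε ^ (k + 1) • N

theorem HasLead.mem {k : ℕ} {u : Sˣ} {M : S} (h : HasLead ε k u M) : u ∈ congrUnits ε S k := by
  obtain ⟨N, hN⟩ := h
  exact ⟨M + ε • N, by rw [hN, smul_add, smul_smul, ← pow_succ, add_assoc]⟩

/-- Expresses the group commutator through the ring commutator. Scalars and constants cancel in the
latter, which is why congruence orders add. -/
theorem coe_commutatorElement_sub_one (u v : Sˣ) :
    ((⁅u, v⁆ : Sˣ) : S) = 1 + ((u : S) * v - v * u) * ((v * u)⁻¹ : Sˣ) := by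
  have h : ((⁅u, v⁆ : Sˣ) : S) = (u * v : S) * ((v * u)⁻¹ : Sˣ) := by
    rw [← Units.val_mul, ← Units.val_mul]
    congr 1
    rw [commutatorElement_def]
    group
  rw [h, sub_mul, ← Units.val_mul v u, Units.mul_inv]
  abel

theorem commutator_mem_congrUnits {a b : ℕ} {u v : Sˣ} (hu : u ∈ congrUnits ε S a)
    (hv : v ∈ congrUnits ε S b) : ⁅u, v⁆ ∈ congrUnits ε S (a + b) := by
  obtain ⟨M, hM⟩ := hu
  obtain ⟨N, hN⟩ := hv
  refine ⟨(M * N - N * M) * ((v * u)⁻¹ : Sˣ), ?_⟩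
  rw [coe_commutatorElement_sub_one, ← smul_mul_assoc]
  congr 2
  rw [hM, hN]
  simp only [mul_add, add_mul, one_mul, mul_one, smul_mul_assoc, mul_smul_comm]
  module

theorem HasLead.commutator {a b : ℕ} {u v : Sˣ} {M N : S} (ha : 0 < a) (hb : 0 < b)
    (hu : HasLead ε a u M) (hv : HasLead ε b v N) :
    HasLead ε (a + b) ⁅u, v⁆ (M * N - N * M) := by
  -- Positivity of both orders makes the correcting factor congruent to `1`, so it does not affect
  -- the leading term.
  obtain ⟨c, hc⟩ : ∃ C : S, (((v * u)⁻¹ : Sˣ) : S) = 1 + ε • C := by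
    have h1 : ∀ {k : ℕ} {w : Sˣ}, 0 < k → w ∈ congrUnits ε S k → w ∈ congrUnits ε S 1 := by
      rintro k w hk ⟨L, hL⟩
      obtain ⟨m, rfl⟩ := Nat.exists_eq_succ_of_ne_zero hk.ne'
      exact ⟨ε ^ m • L, by rw [hL, smul_smul, pow_one, pow_succ']⟩
    obtain ⟨C, hC⟩ := inv_mem (mul_mem (h1 hb hv.mem) (h1 ha hu.mem))
    exact ⟨C, by rw [hC, pow_one]⟩
  obtain ⟨M', hM⟩ := hu
  obtain ⟨N', hN⟩ := hv
  refine ⟨(M * N' - N' * M) + (M' * N - N * M') + ε • (M' * N' - N' * M') +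
    ((M + ε • M') * (N + ε • N') - (N + ε • N') * (M + ε • M')) * c, ?_⟩
  have h : (u : S) * v - v * u =
      ε ^ (a + b) • ((M + ε • M') * (N + ε • N') - (N + ε • N') * (M + ε • M')) := by
    rw [hM, hN]
    simp only [mul_add, add_mul, one_mul, mul_one, smul_mul_assoc, mul_smul_comm]
    module
  rw [coe_commutatorElement_sub_one, h, hc, add_assoc]
  congr 1
  simp only [mul_add, add_mul, mul_one, smul_mul_assoc, mul_smul_comm, sub_mul]
  module

theorem HasLead.inv_mul {k : ℕ} {u v : Sˣ} {M N : S} (hk : 0 < k)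
    (hu : HasLead ε k u M) (hv : HasLead ε k v N) : HasLead ε k (u⁻¹ * v) (N - M) := by
  obtain ⟨m, rfl⟩ : ∃ m, k = m + 1 := ⟨k - 1, by omega⟩
  obtain ⟨C, hC⟩ := inv_mem hu.mem
  obtain ⟨M', hM⟩ := hu
  obtain ⟨N', hN⟩ := hv
  have h : ((u⁻¹ * v : Sˣ) : S) = 1 + (u⁻¹ : Sˣ) * ((v : S) - u) := by
    rw [mul_sub, Units.inv_mul, Units.val_mul]
    abel
  refine ⟨N' - M' + ε ^ m • (C * (N - M)) + ε ^ (m + 1) • (C * (N' - M')), ?_⟩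
  rw [h, hC, hM, hN]
  simp only [mul_add, add_mul, one_mul, smul_mul_assoc, mul_smul_comm, mul_sub]
  module

/-- Only the residue of `v` modulo `ε` matters for the leading term. It is applied with `v` the
image of some `σ_j` and `p` its permutation matrix. -/
theorem HasLead.conj {k : ℕ} {u v p : Sˣ} {M : S} (hu : HasLead ε k u M)
    (hv : ∃ N : S, (v : S) = p + ε • N) :
    HasLead ε k (v * u * v⁻¹) (p * M * (p⁻¹ : Sˣ)) := by
  obtain ⟨N, hN⟩ := hv
  obtain ⟨M', hM⟩ := hu
  have h : (v : S) * M * (v⁻¹ : Sˣ) =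
      p * M * (p⁻¹ : Sˣ) + ε • ((N * M - p * M * (p⁻¹ : Sˣ) * N) * (v⁻¹ : Sˣ)) := by
    have h1 : (v : S) * M = p * M * (p⁻¹ : Sˣ) * v + ε • (N * M - p * M * (p⁻¹ : Sˣ) * N) := by
      rw [hN, mul_add, Units.inv_mul_cancel_right, add_mul, smul_sub, smul_mul_assoc,
        mul_smul_comm]
      abel
    rw [h1, add_mul, Units.mul_inv_cancel_right, smul_mul_assoc]
  refine ⟨(N * M - p * M * (p⁻¹ : Sˣ) * N) * (v⁻¹ : Sˣ) + v * M' * (v⁻¹ : Sˣ), ?_⟩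
  rw [Units.val_mul, Units.val_mul, hM, mul_add, mul_add, mul_one, add_mul, add_mul, Units.mul_inv,
    mul_smul_comm, mul_smul_comm, smul_mul_assoc, smul_mul_assoc, h, smul_add, smul_add, smul_smul,
    ← pow_succ]
  abel

/-- The detection criterion: without `ε`-torsion, a leading term not divisible by `ε` keeps `u` out
of the next congruence subgroup. -/
theorem HasLead.of_mem_congrUnits {k : ℕ} {u : Sˣ} {M : S} (hu : HasLead ε k u M)
    (h : u ∈ congrUnits ε S (k + 1)) (hε : ∀ x y : S, ε • x = ε • y → x = y) :
    ∃ N : S, M = ε • N := by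
  obtain ⟨N, hN⟩ := hu
  obtain ⟨N', hN'⟩ := h
  have hk : ∀ m : ℕ, ∀ x y : S, ε ^ m • x = ε ^ m • y → x = y := by
    intro m
    induction m with
    | zero => intro x y h; simpa using h
    | succ m ih =>
      intro x y h
      rw [pow_succ, mul_smul, mul_smul] at h
      exact hε _ _ (ih _ _ h)
  refine ⟨N' - N, hk k _ _ ?_⟩
  rw [hN, add_assoc, add_right_inj] at hN'
  rw [smul_smul, ← pow_succ, smul_sub, ← hN', add_sub_cancel_right]

end Congruence

/-! ### The Burau representation near the permutation representation -/

section Burau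

variable {R : Type*} [CommRing R]

/-- The permutation representation on functions. -/
def permRep (R ι : Type*) [CommRing R] : Equiv.Perm ι →* (Module.End R (ι → R))ˣ :=
  MonoidHom.toHomUnits
    { toFun := fun π => LinearMap.funLeft R R (π⁻¹ : Equiv.Perm ι)
      map_one' := rfl
      map_mul' := fun π ρ => by
        rw [mul_inv_rev]
        rfl }

theorem permRep_apply {ι : Type*} (π : Equiv.Perm ι) (v : ι → R) (i : ι) :
    (permRep R ι π : Module.End R (ι → R)) v i = v (π⁻¹ i) :=
  rfl

section Generators

variable {ι : Type*} [DecidableEq ι]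

/-- The Burau matrix with parameter `t` in the coordinates `a` and `b`. -/
def burauLin (t : R) (a b : ι) : Module.End R (ι → R) where
  toFun v i := if i = a then (1 - t) * v a + t * v b else if i = b then v a else v i
  map_add' v w := by
    ext i
    simp only [Pi.add_apply]
    split_ifs <;> ring
  map_smul' c v := by
    ext i
    simp only [Pi.smul_apply, smul_eq_mul, RingHom.id_apply]
    split_ifs <;> ring

theorem burauLin_apply (t : R) (a b : ι) (v : ι → R) (i : ι) :
    burauLin t a b v i = if i = a then (1 - t) * v a + t * v b else if i = b then v a else v i :=
  rfl

/-- The Burau matrix as an invertible endomorphism. -/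
def burauUnit (t : Rˣ) {a b : ι} (hab : a ≠ b) : (Module.End R (ι → R))ˣ where
  val := burauLin (t : R) a b
  inv :=
    { toFun := fun v i => if i = b then (t⁻¹ : Rˣ) * (v a - (1 - t) * v b) else
        if i = a then v b else v i
      map_add' := fun v w => by
        ext i
        simp only [Pi.add_apply]
        split_ifs <;> ring
      map_smul' := fun c v => by
        ext i
        simp only [Pi.smul_apply, smul_eq_mul, RingHom.id_apply]
        split_ifs <;> ring }
  val_inv := by
    refine LinearMap.ext fun v => funext fun i => ?_
    simp only [Module.End.mul_apply, burauLin_apply, LinearMap.coe_mk, AddHom.coe_mk,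
      Module.End.one_apply, if_pos, if_neg hab]
    split_ifs with h1 h2
    · subst h1
      rw [Units.mul_inv_cancel_left]
      ring
    · rw [h2]
    · rfl
  inv_val := by
    refine LinearMap.ext fun v => funext fun i => ?_
    simp only [Module.End.mul_apply, burauLin_apply, LinearMap.coe_mk, AddHom.coe_mk,
      Module.End.one_apply, if_pos, if_neg hab.symm]
    split_ifs with h1 h2
    · subst h1
      rw [add_sub_cancel_left, Units.inv_mul_cancel_left]
    · rw [h2]
    · rfl

theorem burauUnit_far (t : Rˣ) {a b c d : ι} (hab : a ≠ b) (hcd : c ≠ d) (hac : a ≠ c)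
    (had : a ≠ d) (hbc : b ≠ c) (hbd : b ≠ d) :
    burauUnit t hab * burauUnit t hcd = burauUnit t hcd * burauUnit t hab := by
  refine Units.ext (LinearMap.ext fun v => funext fun i => ?_)
  simp only [Units.val_mul, Module.End.mul_apply, burauUnit, burauLin_apply, if_neg hac, if_neg had,
    if_neg hbc, if_neg hbd, if_neg hac.symm, if_neg had.symm, if_neg hbc.symm, if_neg hbd.symm]
  split_ifs <;> simp_all

theorem burauUnit_braid (t : Rˣ) {a b c : ι} (hab : a ≠ b) (hbc : b ≠ c) (hac : a ≠ c) :
    burauUnit t hbc * burauUnit t hab * burauUnit t hbc =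
      burauUnit t hab * burauUnit t hbc * burauUnit t hab := by
  refine Units.ext (LinearMap.ext fun v => funext fun i => ?_)
  simp only [Units.val_mul, Module.End.mul_apply, burauUnit, burauLin_apply, if_pos, if_neg hac,
    if_neg hab, if_neg hbc, if_neg hac.symm, if_neg hab.symm, if_neg hbc.symm]
  by_cases h1 : i = a
  · subst h1
    simp only [if_pos, if_neg hab, if_neg hac]
    ring
  by_cases h2 : i = b
  · subst h2
    simp only [if_pos, if_neg hbc, if_neg h1]
  by_cases h3 : i = c
  · subst h3
    simp only [if_pos, if_neg h1, if_neg h2]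
  simp only [if_neg h1, if_neg h2, if_neg h3]

/-- The first order term of the Burau matrix. -/
def burauFst (R : Type*) [CommRing R] (a b : ι) : Module.End R (ι → R) where
  toFun v i := if i = a then v b - v a else 0
  map_add' v w := by
    ext i
    simp only [Pi.add_apply]
    split_ifs <;> ring
  map_smul' c v := by
    ext i
    simp only [Pi.smul_apply, smul_eq_mul, RingHom.id_apply]
    split_ifs <;> ring

theorem coe_burauUnit (t : Rˣ) {a b : ι} (hab : a ≠ b) :
    (burauUnit t hab : Module.End R (ι → R)) =
      permRep R ι (Equiv.swap a b) + ((t : R) - 1) • burauFst R a b := by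
  refine LinearMap.ext fun v => funext fun i => ?_
  change (if i = a then (1 - (t : R)) * v a + t * v b else if i = b then v a else v i) =
    v ((Equiv.swap a b)⁻¹ i) + ((t : R) - 1) * (if i = a then v b - v a else 0)
  rw [Equiv.swap_inv]
  by_cases h1 : i = a
  · subst h1
    rw [if_pos rfl, if_pos rfl, Equiv.swap_apply_left]
    ring
  by_cases h2 : i = b
  · subst h2
    rw [if_neg h1, if_pos rfl, if_neg h1, Equiv.swap_apply_right]
    ring
  rw [if_neg h1, if_neg h2, if_neg h1, Equiv.swap_apply_of_ne_of_ne h1 h2]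
  ring

/-- Writing the matrix as `P + ε D` with `P` the transposition, its square is `1 + ε (P D + D P) +
ε² D²`, and `P D + D P = 1 - P`. -/
theorem hasLead_burauUnit_sq (t : Rˣ) {a b : ι} (hab : a ≠ b) :
    HasLead ((t : R) - 1) 1 (burauUnit t hab ^ 2) (1 - permRep R ι (Equiv.swap a b) :
      Module.End R (ι → R)) := by
  have h1 : (permRep R ι (Equiv.swap a b) : Module.End R (ι → R)) *
      permRep R ι (Equiv.swap a b) = 1 := by
    rw [← Units.val_mul, ← map_mul, Equiv.swap_mul_self, map_one, Units.val_one]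
  have h2 : (permRep R ι (Equiv.swap a b) : Module.End R (ι → R)) * burauFst R a b +
      burauFst R a b * permRep R ι (Equiv.swap a b) = 1 - permRep R ι (Equiv.swap a b) := by
    refine LinearMap.ext fun v => funext fun i => ?_
    change (if (Equiv.swap a b)⁻¹ i = a then v b - v a else 0) +
      (if i = a then v ((Equiv.swap a b)⁻¹ b) - v ((Equiv.swap a b)⁻¹ a) else 0) =
      v i - v ((Equiv.swap a b)⁻¹ i)
    rw [Equiv.swap_inv]
    by_cases h3 : i = a
    · subst h3
      rw [if_pos rfl, Equiv.swap_apply_left, Equiv.swap_apply_right, if_neg hab.symm, zero_add]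
    by_cases h4 : i = b
    · subst h4
      rw [Equiv.swap_apply_right, if_pos rfl, if_neg h3, add_zero]
    rw [Equiv.swap_apply_of_ne_of_ne h3 h4, if_neg h3, if_neg h3, sub_self, add_zero]
  refine ⟨burauFst R a b * burauFst R a b, ?_⟩
  rw [← h2, pow_two, Units.val_mul, coe_burauUnit, add_mul, mul_add, mul_add, h1]
  simp only [smul_mul_assoc, mul_smul_comm]
  module

end Generators

theorem fin_val_ne_succ {n : ℕ} (k : Fin (n - 1)) :
    (⟨k.val, by omega⟩ : Fin n) ≠ ⟨k.val + 1, by omega⟩ := by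
  simp

/-- The Burau representation of the braid group. -/
def burau (t : Rˣ) (n : ℕ) : Braid n →* (Module.End R (Fin n → R))ˣ :=
  PresentedGroup.toGroup (f := fun k : Fin (n - 1) =>
    burauUnit t (fin_val_ne_succ k)) <| by
  rintro w (⟨i, j, hij, rfl⟩ | ⟨i, j, hij, rfl⟩)
  · simp only [map_mul, map_inv, FreeGroup.lift_apply_of]
    rw [mul_inv_eq_one]
    apply burauUnit_far <;> rw [Ne, Fin.ext_iff] <;> dsimp only <;> omega
  · simp only [map_mul, map_inv, FreeGroup.lift_apply_of]
    rw [mul_inv_eq_one]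
    obtain ⟨i, hi⟩ := i
    obtain ⟨j, hj⟩ := j
    obtain rfl : i + 1 = j := hij
    exact burauUnit_braid t _ _ (by simp [Fin.ext_iff]; omega)

theorem burau_elemBraid (t : Rˣ) (n : ℕ) (k : Fin (n - 1)) :
    burau t n (elemBraid n k) =
      burauUnit t (fin_val_ne_succ k) :=
  PresentedGroup.toGroup.of _

theorem burau_eq_permRep_add (t : Rˣ) (n : ℕ) (b : Braid n) :
    ∃ N : Module.End R (Fin n → R), (burau t n b : Module.End R (Fin n → R)) =
      permRep R (Fin n) (braidToPerm n b) + ((t : R) - 1) • N := by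
  induction b using Braid.induction with
  | one => exact ⟨0, by simp⟩
  | of k =>
    rw [burau_elemBraid, braidToPerm_elemBraid]
    exact ⟨_, coe_burauUnit t _⟩
  | mul b c hb hc =>
    obtain ⟨M, hM⟩ := hb
    obtain ⟨N, hN⟩ := hc
    refine ⟨permRep R (Fin n) (braidToPerm n b) * N +
      M * permRep R (Fin n) (braidToPerm n c) + ((t : R) - 1) • (M * N), ?_⟩
    rw [map_mul, Units.val_mul, hM, hN, map_mul, map_mul, Units.val_mul]
    simp only [add_mul, mul_add, smul_mul_assoc, mul_smul_comm]
    module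
  | inv b hb =>
    obtain ⟨N, hN⟩ := hb
    set u := burau t n b
    set p := permRep R (Fin n) (braidToPerm n b) with hp
    refine ⟨-((u⁻¹ : (Module.End R (Fin n → R))ˣ) * N *
      (p⁻¹ : (Module.End R (Fin n → R))ˣ)), ?_⟩
    have h : (u⁻¹ : (Module.End R (Fin n → R))ˣ) * (u : Module.End R (Fin n → R)) *
        (p⁻¹ : (Module.End R (Fin n → R))ˣ) = (p⁻¹ : (Module.End R (Fin n → R))ˣ) := by
      rw [Units.inv_mul, one_mul]
    rw [hN, mul_add, add_mul, mul_assoc, Units.mul_inv, mul_one, mul_smul_comm,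
      smul_mul_assoc] at h
    rw [map_inv, map_inv, map_inv, ← hp, smul_neg, ← sub_eq_add_neg]
    exact eq_sub_of_add_eq h

theorem burau_mem_congrUnits (t : Rˣ) {n : ℕ} {b : Braid n} (hb : b ∈ PureBraid n) :
    burau t n b ∈ congrUnits ((t : R) - 1) (Module.End R (Fin n → R)) 1 := by
  obtain ⟨N, hN⟩ := burau_eq_permRep_add t n b
  rw [MonoidHom.mem_ker.mp hb, map_one, Units.val_one] at hN
  exact ⟨N, by rw [hN, pow_one]⟩

/-- Pure braids map to `1` modulo `t - 1`, and congruence orders add under commutators. The shift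
occurs because Mathlib's term `k` is `Γ_{k+1}`. -/
theorem burau_lowerCentralSeries (t : Rˣ) (n k : ℕ) :
    (⊤ : Subgroup (PureBraid n)).lowerCentralSeries k ≤
      (congrUnits ((t : R) - 1) (Module.End R (Fin n → R)) (k + 1)).comap
        ((burau t n).comp (PureBraid n).subtype) := by
  induction k with
  | zero => exact fun p _ => burau_mem_congrUnits t p.2
  | succ k ih =>
    rw [Subgroup.lowerCentralSeries_succ, Subgroup.commutator_le]
    intro g hg h _
    rw [Subgroup.mem_comap, map_commutatorElement]
    exact commutator_mem_congrUnits (ih hg) (burau_mem_congrUnits t h.2)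

theorem hasLead_burau_pureGenNat (t : Rˣ) (n : ℕ) {i : ℕ} (d : ℕ) (hd : i + 1 + d < n) :
    HasLead ((t : R) - 1) 1 (burau t n (pureGenNat n i (i + 1 + d)))
      (1 - permRep R (Fin n) (Equiv.swap ⟨i, by omega⟩ ⟨i + 1 + d, hd⟩) :
        Module.End R (Fin n → R)) := by
  induction d with
  | zero =>
    change HasLead _ 1 (burau t n (pureGenNat n i (i + 1))) _
    rw [pureGenNat_self_succ, elemBraidNat_of_lt (show i < n - 1 by omega), map_pow,
      burau_elemBraid]
    exact hasLead_burauUnit_sq t _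
  | succ d ih =>
    change HasLead _ 1 (burau t n (pureGenNat n i (i + 1 + d + 1))) _
    rw [pureGenNat_succ n (by omega), map_mul, map_mul, map_inv,
      elemBraidNat_of_lt (show i + 1 + d < n - 1 by omega)]
    have h := (ih (by omega)).conj
      (burau_eq_permRep_add t n (elemBraid n ⟨i + 1 + d, by omega⟩))
    have e1 : adjSwap n ⟨i + 1 + d, by omega⟩ ⟨i, by omega⟩ = ⟨i, by omega⟩ := by
      refine Equiv.swap_apply_of_ne_of_ne ?_ ?_ <;> rw [Ne, Fin.mk.injEq] <;> dsimp only <;> omega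
    have e2 : adjSwap n ⟨i + 1 + d, by omega⟩ ⟨i + 1 + d, by omega⟩ = ⟨i + 1 + (d + 1), hd⟩ :=
      Equiv.swap_apply_left _ _
    have e3 : ∀ π σ : Equiv.Perm (Fin n), (permRep R (Fin n) π : Module.End R (Fin n → R)) *
        (1 - permRep R (Fin n) σ : Module.End R (Fin n → R)) *
          ((permRep R (Fin n) π)⁻¹ : (Module.End R (Fin n → R))ˣ) =
        1 - permRep R (Fin n) (π * σ * π⁻¹) := by
      intro π σ
      rw [mul_sub, sub_mul, mul_one, Units.mul_inv, ← Units.val_mul, ← Units.val_mul, ← map_mul,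
        ← map_inv, ← map_mul]
    rw [braidToPerm_elemBraid, e3, Equiv.mul_swap_eq_swap_mul, mul_inv_cancel_right, e1, e2] at h
    exact h

theorem hasLead_burau_pureGenSym (t : Rˣ) {n : ℕ} {i j : Fin n} (hij : i ≠ j) :
    HasLead ((t : R) - 1) 1 (burau t n (pureGenSym n i j))
      (1 - permRep R (Fin n) (Equiv.swap i j) : Module.End R (Fin n → R)) := by
  wlog h : i < j generalizing i j
  · rw [pureGenSym_comm, Equiv.swap_comm]
    exact this hij.symm (lt_of_le_of_ne (not_lt.mp h) hij.symm)
  rw [pureGenSym_of_lt h]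
  obtain ⟨i, hi⟩ := i
  obtain ⟨j, hj⟩ := j
  have h' : i < j := h
  obtain ⟨d, rfl⟩ : ∃ d, j = i + 1 + d := ⟨j - (i + 1), by omega⟩
  exact hasLead_burau_pureGenNat t n d hj

end Burau

/-! ### Faithfulness of the action of the symmetric group -/

/-- Lifts the equality from the quotient by the centre to `P_n`: `Γ_3` of the quotient is the image
of `Γ_3(P_n)`, so the lift is determined up to a central factor. -/
theorem exists_of_alphaSym_eq {n : ℕ} {r s t x y z : Fin n}
    (h : alphaSym n r s t = alphaSym n x y z) :
    ∃ w ∈ Gam (PureBraid n) 3, ∃ c ∈ Subgroup.center (PureBraid n),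
      ⁅pureGenSym n r s, pureGenSym n s t⁆⁻¹ * ⁅pureGenSym n x y, pureGenSym n y z⁆ = w * c := by
  have h1 := gamComm_eq_iff.mp h
  have h2 : Gam (PureBraidBar n) 3 =
      (Gam (PureBraid n) 3).map (QuotientGroup.mk' (Subgroup.center (PureBraid n))) := by
    rw [Subgroup.map_lowerCentralSeries,
      Subgroup.map_top_of_surjective _ (QuotientGroup.mk'_surjective _)]
  rw [h2] at h1
  obtain ⟨w, hw, hw'⟩ := h1
  exact ⟨w, hw, _, QuotientGroup.eq.mp hw', (mul_inv_cancel_left _ _).symm⟩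

/-- This is the `(x, x)` entry of a double ring commutator. The `x, y, z` part equals `2 ((y z) - (x
z))` as permutation matrices and contributes `2`. The `r, s, t` part contributes `0`, because its
permutations fix `x`. -/
theorem permRep_bracket_apply {R ι : Type*} [CommRing R] [DecidableEq ι] {r s t x y z : ι}
    (hxy : x ≠ y) (hyz : y ≠ z) (hxz : x ≠ z) (hxr : x ≠ r) (hxs : x ≠ s) (hxt : x ≠ t) :
    let X : ι → ι → Module.End R (ι → R) := fun i j => 1 - permRep R ι (Equiv.swap i j)
    ((X x y * X y z - X y z * X x y - (X r s * X s t - X s t * X r s)) * X x y -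
      X x y * (X x y * X y z - X y z * X x y - (X r s * X s t - X s t * X r s)))
        (Pi.single x 1) x = 2 := by
  have hne : ∀ {a b i : ι}, x ≠ a → x ≠ b → i ≠ x → Equiv.swap a b i ≠ x := by
    intro a b i ha hb hi h
    rw [← Equiv.swap_apply_of_ne_of_ne ha hb] at h
    exact hi ((Equiv.swap a b).injective h)
  have h1 : Equiv.swap r s y ≠ x := hne hxr hxs hxy.symm
  have h2 : Equiv.swap s t y ≠ x := hne hxs hxt hxy.symm
  simp only [LinearMap.sub_apply, Pi.sub_apply, Module.End.mul_apply, Module.End.one_apply,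
    permRep_apply, Equiv.swap_inv, Equiv.swap_apply_left, Equiv.swap_apply_right,
    Equiv.swap_apply_of_ne_of_ne hxr hxs, Equiv.swap_apply_of_ne_of_ne hxs hxt,
    Equiv.swap_apply_of_ne_of_ne hxy hxz, Equiv.swap_apply_of_ne_of_ne hxz.symm hyz.symm,
    Pi.single_apply, if_neg h1, if_neg h2, if_neg (hne hxr hxs h2), if_neg (hne hxs hxt h1),
    if_pos, if_neg hxy.symm, if_neg hxz.symm]
  ring_nf

theorem alphaSym_ne {n : ℕ} {r s t x y z : Fin n} (hrs : r ≠ s) (hst : s ≠ t)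
    (hxy : x ≠ y) (hyz : y ≠ z) (hxz : x ≠ z) (hxr : x ≠ r) (hxs : x ≠ s) (hxt : x ≠ t) :
    alphaSym n r s t ≠ alphaSym n x y z := by
  intro h
  obtain ⟨w, hw, c, hc, hwc⟩ := exists_of_alphaSym_eq h
  -- The parameter `1 + X` is invertible, while `τ - 1 = X` is a non-zero-divisor that does not
  -- divide `2`.
  obtain ⟨τ, hτ⟩ : IsUnit (1 + PowerSeries.X : PowerSeries ℤ) :=
    PowerSeries.isUnit_iff_constantCoeff.mpr (by simp)
  have hε : (τ : PowerSeries ℤ) - 1 = PowerSeries.X := by rw [hτ, add_sub_cancel_left]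
  set f : PureBraid n →* (Module.End (PowerSeries ℤ) (Fin n → PowerSeries ℤ))ˣ := (burau τ n).comp (PureBraid n).subtype with hf
  have hlead : ∀ {i j : Fin n}, i ≠ j → HasLead (PowerSeries.X : PowerSeries ℤ) 1
      (f (pureGenSym n i j)) (1 - permRep (PowerSeries ℤ) (Fin n) (Equiv.swap i j) :
        Module.End (PowerSeries ℤ) (Fin n → PowerSeries ℤ)) := by
    intro i j hij
    rw [← hε]
    exact hasLead_burau_pureGenSym τ hij
  set g := ⁅pureGenSym n r s, pureGenSym n s t⁆
  set g' := ⁅pureGenSym n x y, pureGenSym n y z⁆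
  set q := pureGenSym n x y
  have h4 : f ⁅g⁻¹ * g', q⁆ ∈ congrUnits (PowerSeries.X : PowerSeries ℤ)
      (Module.End (PowerSeries ℤ) (Fin n → PowerSeries ℤ)) 4 := by
    -- Taking the commutator with `q` removes the unknown central factor `c`.
    have h5 : ⁅g⁻¹ * g', q⁆ = ⁅w, q⁆ := by
      have hcq : c * q = q * c := (Subgroup.mem_center_iff.mp hc q).symm
      rw [hwc, commutatorElement_def, commutatorElement_def, mul_inv_rev, mul_assoc w, hcq]
      group
    rw [h5, ← hε]
    exact burau_lowerCentralSeries τ n 3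
      (Subgroup.commutator_mem_commutator hw (Subgroup.mem_top q))
  have h5 := HasLead.commutator (by norm_num) (by norm_num)
    (HasLead.inv_mul (by norm_num)
      (HasLead.commutator (by norm_num) (by norm_num) (hlead hrs) (hlead hst))
      (HasLead.commutator (by norm_num) (by norm_num) (hlead hxy) (hlead hyz))) (hlead hxy)
  rw [← map_commutatorElement, ← map_commutatorElement, ← map_inv, ← map_mul,
    ← map_commutatorElement] at h5
  obtain ⟨N, hN⟩ := h5.of_mem_congrUnits h4 (by
    intro u v huv
    refine LinearMap.ext fun a => funext fun i => ?_
    exact mul_left_cancel₀ PowerSeries.X_ne_zero (congrFun (LinearMap.congr_fun huv a) i))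
  have hev := congrFun (LinearMap.congr_fun hN (Pi.single x 1)) x
  have hX : (PowerSeries.X : PowerSeries ℤ) ∣ 2 := by
    refine ⟨N (Pi.single x 1) x, ?_⟩
    rw [LinearMap.smul_apply, Pi.smul_apply, smul_eq_mul] at hev
    rw [← hev]
    exact (permRep_bracket_apply hxy hyz hxz hxr hxs hxt).symm
  rw [PowerSeries.X_dvd_iff, map_ofNat] at hX
  norm_num at hX

theorem braidAct_eq_one_iff {n : ℕ} (hn : 4 ≤ n) (b : Braid n) :
    braidAct n b = 1 ↔ b ∈ PureBraid n := by
  refine ⟨fun h => ?_, braidAct_of_mem n⟩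
  rw [MonoidHom.mem_ker]
  by_contra hb
  obtain ⟨r, hr⟩ : ∃ r, braidToPerm n b r ≠ r := by
    by_contra! hall
    exact hb (Equiv.ext hall)
  -- Choosing both `s` and `t` outside `r` and its image is where `4 ≤ n` enters. The image of `r`
  -- then avoids `r`, `s` and `t`, as `alphaSym_ne` demands.
  obtain ⟨s, hs⟩ : ∃ s, s ∉ ({r, braidToPerm n b r} : Finset (Fin n)) := by
    by_contra! hall
    have h1 := Finset.card_le_card (fun i _ => hall i : Finset.univ ⊆ _)
    have h2 := Finset.card_le_two (a := r) (b := braidToPerm n b r)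
    rw [Finset.card_univ, Fintype.card_fin] at h1
    omega
  obtain ⟨t, ht⟩ : ∃ t, t ∉ ({r, braidToPerm n b r, s} : Finset (Fin n)) := by
    by_contra! hall
    have h1 := Finset.card_le_card (fun i _ => hall i : Finset.univ ⊆ _)
    have h2 := Finset.card_le_three (a := r) (b := braidToPerm n b r) (c := s)
    rw [Finset.card_univ, Fintype.card_fin] at h1
    omega
  simp only [Finset.mem_insert, Finset.mem_singleton, not_or] at hs ht
  have hrs : r ≠ s := fun e => hs.1 e.symm
  have hst : s ≠ t := fun e => ht.2.2 e.symm
  have hrt : r ≠ t := fun e => ht.1 e.symm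
  have hinj := (braidToPerm n b).injective
  have key := braidAct_alphaSym n b hrs hst
  rw [h, MulAut.one_apply] at key
  exact alphaSym_ne hrs hst (hinj.ne hrs) (hinj.ne hst) (hinj.ne hrt) hr
    (fun e => hs.2 e.symm) (fun e => ht.2.1 e.symm) key

/-! ### The isomorphism with the symmetric group -/

theorem range_braidAct (n : ℕ) : (braidAct n).range = omegaSubgroup n := by
  apply le_antisymm
  · rintro _ ⟨b, rfl⟩
    induction b using Braid.induction with
    | one => rw [map_one]; exact one_mem _
    | of k =>
      -- `ω_k` is conjugation by `σ_k⁻¹`, so the generator appears after inversion.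
      rw [← inv_mem_iff, ← map_inv]
      exact Subgroup.subset_closure (Set.mem_range_self k)
    | mul b c hb hc => rw [map_mul]; exact mul_mem hb hc
    | inv b hb => rw [map_inv]; exact inv_mem hb
  · rw [omegaSubgroup, Subgroup.closure_le]
    rintro _ ⟨k, rfl⟩
    exact ⟨(elemBraid n k)⁻¹, rfl⟩

theorem mainTheorem6 (n : ℕ) (hn : 4 ≤ n) :
    ∃ e : omegaSubgroup n ≃* Equiv.Perm (Fin n),
      (∀ k : Fin (n - 1),
        e ⟨braidPhi n 2 (braidOmega n k), Subgroup.subset_closure (Set.mem_range_self k)⟩ =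
          adjSwap n k) ∧
      ∀ (α : MulAut (PureBraid n)) (hα : braidPhi n 2 α ∈ omegaSubgroup n)
        (π : Equiv.Perm (Fin n)), e ⟨braidPhi n 2 α, hα⟩ = π →
        ∀ r s t : Fin n, r < s → s < t →
          (π r < π s → π s < π t →
            braidPhi n 2 α (alphaElt n r s t) = alphaElt n (π r) (π s) (π t)) ∧
          (π s < π t → π t < π r →
            braidPhi n 2 α (alphaElt n r s t) = alphaElt n (π s) (π t) (π r)) ∧
          (π t < π r → π r < π s →
            braidPhi n 2 α (alphaElt n r s t) = alphaElt n (π t) (π r) (π s)) ∧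
          (π r < π t → π t < π s →
            braidPhi n 2 α (alphaElt n r s t) = (alphaElt n (π r) (π t) (π s))⁻¹) ∧
          (π s < π r → π r < π t →
            braidPhi n 2 α (alphaElt n r s t) = (alphaElt n (π s) (π r) (π t))⁻¹) ∧
          (π t < π s → π s < π r →
            braidPhi n 2 α (alphaElt n r s t) = (alphaElt n (π t) (π s) (π r))⁻¹) := by
  have hker : (braidToPerm n).ker = (braidAct n).ker := by
    ext b
    exact (braidAct_eq_one_iff hn b).symm
  -- The actions on strands and on `Γ_2/Γ_3` have the same kernel `P_n`, so both images are
  -- identified with `B_n / P_n`.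
  let e : omegaSubgroup n ≃* Equiv.Perm (Fin n) :=
    (MulEquiv.subgroupCongr (range_braidAct n)).symm.trans <|
      (QuotientGroup.quotientKerEquivRange (braidAct n)).symm.trans <|
        (QuotientGroup.quotientMulEquivOfEq hker.symm).trans <|
          QuotientGroup.quotientKerEquivOfSurjective _ (braidToPerm_surjective n)
  have he : ∀ (b : Braid n) (hb : braidAct n b ∈ omegaSubgroup n),
      e ⟨braidAct n b, hb⟩ = braidToPerm n b := by
    intro b hb
    have h1 : (QuotientGroup.quotientKerEquivRange (braidAct n)).symm ⟨braidAct n b, ⟨b, rfl⟩⟩ =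
        (b : Braid n ⧸ (braidAct n).ker) := by
      rw [MulEquiv.symm_apply_eq]
      rfl
    change QuotientGroup.quotientKerEquivOfSurjective _ (braidToPerm_surjective n)
      (QuotientGroup.quotientMulEquivOfEq hker.symm
        ((QuotientGroup.quotientKerEquivRange (braidAct n)).symm ⟨braidAct n b, ⟨b, rfl⟩⟩)) = _
    rw [h1]
    rfl
  refine ⟨e, fun k => ?_, ?_⟩
  · refine (he (elemBraid n k)⁻¹ (Subgroup.subset_closure (Set.mem_range_self k))).trans ?_
    rw [map_inv, braidToPerm_elemBraid]
    exact Equiv.swap_inv _ _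
  · rintro α hα π rfl r s t hrs hst
    -- Only `φ_2(α)` matters, so `α` may be replaced by conjugation by a braid `b` with the same
    -- image.
    obtain ⟨b, hb⟩ : braidPhi n 2 α ∈ (braidAct n).range := by
      rw [range_braidAct]
      exact hα
    have hπ : e ⟨braidPhi n 2 α, hα⟩ = braidToPerm n b := by
      rw [← he b (hb ▸ hα)]
      exact congrArg e (Subtype.ext hb.symm)
    have hinj := (braidToPerm n b).injective
    rw [hπ, ← alphaSym_of_lt hrs hst, ← hb, braidAct_alphaSym n b hrs.ne hst.ne]
    exact alphaSym_cases (hinj.ne hrs.ne) (hinj.ne hst.ne) (hinj.ne (hrs.trans hst).ne)
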